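/- **Setup.** A *path of length $L$ in the $d$-dimensional integer lattice* ($L\in\mathbb{N}_0$) is a map $X:[0,L]\to\mathbb{R}^d$ with $X_k\in\mathbb{Z}^d$ for $k=0,\dots,L$, $\|X_{k+1}-X_k\|=1$ (Euclidean norm) for $0\le k<L$, and $X$ linear on each $[k,k+1]$. Each step $X_{k+1}-X_k$ is $\pm$ a standard basis vector, so $X$ has a word $w_X$ of length $L$ in letters $e_1^{\pm1},\dots,e_d^{\pm1}$; conversely, each word $w$ in such letters has a lattice path $\gamma_w$ started at $0$. A path $X:[0,T]\to\mathbb{R}^d$ is *tree-like* if there is a continuous $h:[0,T]\to[0,\infty)$ with $h(0)=h(T)=0$ and $\|X_t-X_s\|\le h(s)+h(t)-2\inf_{u\in[s,t]}h(u)$ for all $0\le s\le t\le T$. For a lattice path $Y:[0,T]\to\mathbb{R}^2$ and $k\ge 1$, the $k$-th iterated integral of $Y$ is $\int_{0<u_1<\dots<u_k<T}dY_{u_1}\otimes\cdots\otimes dY_{u_k}\in(\mathbb{R}^2)^{\otimes k}$. Its *projection into $GL(2,\mathbb{C})$* is its image under the real algebra homomorphism from the tensor algebra of $\mathbb{R}^2$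 to the $2\times2$ complex matrices that extends $$(x,y)\mapsto\begin{pmatrix}0&x+iy\\x-iy&0\end{pmatrix}.$$ Let $d\ge1$ and $c_d=2\lceil\log_3\frac d2\rceil+3$. Call $f=(f_1,\dots,f_d)$, with each $f_i$ in the free group $\Gamma$ on two letters, a *short embedding* if the homomorphism $e_i\mapsto f_i$ from the free group on $e_1,\dots,e_d$ to $\Gamma$ is injective and each reduced word $f_i$ has length at most $c_d$. Given such an $f$ and a lattice path $X$ in $\mathbb{R}^d$, let $X^f=\gamma_{f(w_X)}$ be the lattice path in $\mathbb{R}^2$ of the word $f(w_X)$ obtained from $w_X$ by replacing each letter $e_i^{\pm1}$ by the reduced word of $f_i^{\pm1}$. **Theorem.** Let $d\ge1$. Short embeddings exist. Moreover, for every short embedding $f$, every $L$ and every path $X$ of length $L$ in the $d$-dimensional integer lattice: if the projections into $GL(2,\mathbb{C})$ of the $k$-th iterated integrals of $X^f$ vanish for all $$1\le k\le\Bigl\lfloor\bigl(2\lceil\log_3\tfrac d2\rceil+3\bigr)\,e\,\log(1+\sqrt2)\,L\Bigr\rfloor,$$ then $X$ is tree-like. -/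

import Mathlib

noncomputable section

namespace LatticeSignature

/-- A path of length `L` in the `n`-dimensional integer lattice: a map `X` on `[0, L]` which visits
lattice points at integer times, consecutive ones at Euclidean distance `1`, and which is linear on
each `[k, k + 1]`. (The values of `X` outside `[0, L]` are irrelevant.) -/
structure IsLatticePath {n : ℕ} (L : ℕ) (X : ℝ → EuclideanSpace ℝ (Fin n)) : Prop where
  lattice : ∀ k : ℕ, k ≤ L → ∀ i : Fin n, ∃ z : ℤ, X k i = z
  unit_step : ∀ k : ℕ, k < L → ‖X (k + 1) - X k‖ = 1
  linear : ∀ k : ℕ, k < L → ∀ s ∈ Set.Icc (0 : ℝ) 1,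
    X (k + s) = X k + s • (X (k + 1) - X k)

/-- The unit vector of a letter: `(i, true)` is the letter `e_i`, `(i, false)` is `e_i⁻¹`
(the convention of `FreeGroup`). -/
def step {n : ℕ} (p : Fin n × Bool) : EuclideanSpace ℝ (Fin n) :=
  EuclideanSpace.single p.1 (if p.2 then (1 : ℝ) else -1)

theorem step_injective {n : ℕ} : Function.Injective (step (n := n)) := by
  rintro ⟨i, b⟩ ⟨j, c⟩ h
  have h1 : step (i, b) i = step (j, c) i := by rw [h]
  by_cases hij : i = j
  · subst hij
    cases b <;> cases c <;> simp [step] at h1 ⊢ <;> norm_num at h1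
  · exfalso
    cases b <;> cases c <;> simp [step, hij] at h1

theorem exists_step_eq {n : ℕ} (v : EuclideanSpace ℝ (Fin n)) (hz : ∀ i, ∃ z : ℤ, v i = z)
    (hv : ‖v‖ = 1) : ∃ p, v = step p := by
  choose z hz using hz
  have h1 : ∑ i, (z i) ^ 2 = 1 := by
    have h2 := EuclideanSpace.norm_sq_eq v
    rw [hv] at h2
    simp only [hz, Real.norm_eq_abs, sq_abs] at h2
    have h3 : ((∑ i, (z i) ^ 2 : ℤ) : ℝ) = 1 := by push_cast; linarith
    exact_mod_cast h3
  obtain ⟨i, hi⟩ : ∃ i, z i ≠ 0 := by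
    by_contra! h
    simp [h] at h1
  have hsum : (z i) ^ 2 + ∑ j ∈ Finset.univ.erase i, (z j) ^ 2 = 1 := by
    rw [← h1]; exact Finset.add_sum_erase _ (fun j => (z j) ^ 2) (Finset.mem_univ i)
  have hnn : ∀ j ∈ Finset.univ.erase i, 0 ≤ (z j) ^ 2 := fun j _ => sq_nonneg _
  have hpos : 0 < (z i) ^ 2 := by positivity
  have hrest : ∑ j ∈ Finset.univ.erase i, (z j) ^ 2 = 0 := by
    have := Finset.sum_nonneg hnn
    omega
  have hz0 : ∀ j, j ≠ i → z j = 0 := by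
    intro j hj
    have := (Finset.sum_eq_zero_iff_of_nonneg hnn).1 hrest j (by simp [hj])
    simpa using this
  have hzi : z i = 1 ∨ z i = -1 := by
    rw [hrest, add_zero] at hsum
    have h : (z i - 1) * (z i + 1) = 0 := by linear_combination hsum
    rcases mul_eq_zero.1 h with h | h
    · left; omega
    · right; omega
  rcases hzi with h | h
  · refine ⟨(i, true), ?_⟩
    ext j
    by_cases hj : j = i
    · subst hj; simp [step, hz, h]
    · simp [step, hz, hz0 j hj, hj]
  · refine ⟨(i, false), ?_⟩
    ext j
    by_cases hj : j = i
    · subst hj; simp [step, hz, h]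
    · simp [step, hz, hz0 j hj, hj]

/-- A lattice path corresponds to exactly one word in the letters `e_i` and their inverses. -/
theorem IsLatticePath.existsUnique_word {n L : ℕ} {X : ℝ → EuclideanSpace ℝ (Fin n)}
    (hX : IsLatticePath L X) :
    ∃! w : Fin L → Fin n × Bool, ∀ k : Fin L, X ((k : ℕ) + 1) - X (k : ℕ) = step (w k) := by
  have h : ∀ k : Fin L, ∃ p, X ((k : ℕ) + 1) - X (k : ℕ) = step p := by
    intro k
    refine exists_step_eq _ (fun i => ?_) (hX.unit_step k k.2)
    obtain ⟨a, ha⟩ := hX.lattice (k + 1) k.2 i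
    obtain ⟨b, hb⟩ := hX.lattice k k.2.le i
    refine ⟨a - b, ?_⟩
    push_cast at ha
    simp [ha, hb]
  choose w hw using h
  exact ⟨w, hw, fun w' hw' => funext fun k => step_injective ((hw' k).symm.trans (hw k))⟩

/-- The word of a lattice path. -/
def IsLatticePath.word {n L : ℕ} {X : ℝ → EuclideanSpace ℝ (Fin n)}
    (hX : IsLatticePath L X) : List (Fin n × Bool) :=
  List.ofFn hX.existsUnique_word.choose

/-- The lattice path of a word, started at `0`; it is run on `[0, w.length]` and traverses the
`k`-th letter of the word at unit speed during `[k, k + 1]`. -/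
def latticePath {n : ℕ} (w : List (Fin n × Bool)) (t : ℝ) : EuclideanSpace ℝ (Fin n) :=
  ∑ k : Fin w.length, max 0 (min 1 (t - (k : ℕ))) • step (w.get k)

/-- Substitution in a word: each letter `e_i` is replaced by the reduced word of `f i`, and each
letter `e_i⁻¹` by the reduced word of `(f i)⁻¹` (concatenation, without any cancellation). -/
def substWord {d n : ℕ} (f : Fin d → FreeGroup (Fin n)) (w : List (Fin d × Bool)) :
    List (Fin n × Bool) :=
  w.flatMap fun p => if p.2 then (f p.1).toWord else ((f p.1)⁻¹).toWord

/-- The coordinate iterated integral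
`∫_{0 < u₁ < ⋯ < u_k < T} dX^{i₁}_{u₁} ⋯ dX^{i_k}_{u_k}` of a piecewise linear
(or Lipschitz) path, for which `dX_u = X'(u) du`; the outermost variable is `u_k`. -/
def coordIteratedIntegral {n : ℕ} (X : ℝ → EuclideanSpace ℝ (Fin n)) :
    (k : ℕ) → (Fin k → Fin n) → ℝ → ℝ
  | 0, _, _ => 1
  | k + 1, i, T => ∫ u in (0 : ℝ)..T,
      coordIteratedIntegral X k (Fin.init i) u * deriv (fun v => X v (i (Fin.last k))) u

/-- The `k`-th iterated integral `∫_{0 < u₁ < ⋯ < u_k < T} dX_{u₁} ⊗ ⋯ ⊗ dX_{u_k}`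
of `X` over `[0, T]`, an element of the tensor algebra. -/
def iteratedIntegral {n : ℕ} (X : ℝ → EuclideanSpace ℝ (Fin n)) (T : ℝ) (k : ℕ) :
    TensorAlgebra ℝ (EuclideanSpace ℝ (Fin n)) :=
  ∑ i : Fin k → Fin n, coordIteratedIntegral X k i T •
    TensorAlgebra.tprod ℝ (EuclideanSpace ℝ (Fin n)) k
      (fun j => EuclideanSpace.single (i j) (1 : ℝ))

/-- The identification of `ℝ²` with a real subspace of the `2 × 2` complex matrices. -/
def planeToMatrix : EuclideanSpace ℝ (Fin 2) →ₗ[ℝ] Matrix (Fin 2) (Fin 2) ℂ where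
  toFun v := !![0, (v 0 : ℂ) + (v 1 : ℂ) * Complex.I; (v 0 : ℂ) - (v 1 : ℂ) * Complex.I, 0]
  map_add' v w := by
    ext i j
    fin_cases i <;> fin_cases j <;> simp <;> ring
  map_smul' c v := by
    ext i j
    fin_cases i <;> fin_cases j <;> simp <;> ring

/-- The `k`-th `GL(2, ℂ)`-iterated integral over `[0, T]` of a path in the plane: the image of its
`k`-th iterated integral under the algebra homomorphism from the tensor algebra of `ℝ²` to the
`2 × 2` complex matrices that extends `planeToMatrix`. -/
def glIteratedIntegral (Y : ℝ → EuclideanSpace ℝ (Fin 2)) (T : ℝ) (k : ℕ) :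
    Matrix (Fin 2) (Fin 2) ℂ :=
  TensorAlgebra.lift ℝ planeToMatrix (iteratedIntegral Y T k)

/-- `X`, defined on `[0, T]`, is tree-like: it has a height function `h`. -/
def IsTreeLike {n : ℕ} (T : ℝ) (X : ℝ → EuclideanSpace ℝ (Fin n)) : Prop :=
  ∃ h : ℝ → ℝ, ContinuousOn h (Set.Icc 0 T) ∧ (∀ t ∈ Set.Icc 0 T, 0 ≤ h t) ∧
    h 0 = 0 ∧ h T = 0 ∧
    ∀ s t : ℝ, 0 ≤ s → s ≤ t → t ≤ T →
      ‖X t - X s‖ ≤ h s + h t - 2 * sInf (h '' Set.Icc s t)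

/-- The constant `2 ⌈log₃ (d / 2)⌉ + 3`. -/
def embeddingLength (d : ℕ) : ℤ := 2 * ⌈Real.logb 3 ((d : ℝ) / 2)⌉ + 3

/-- `f` embeds the free group on `d` letters in the free group on two letters by `e_i ↦ f i`,
with reduced words of length at most `2 ⌈log₃ (d / 2)⌉ + 3`. -/
def IsShortEmbedding {d : ℕ} (f : Fin d → FreeGroup (Fin 2)) : Prop :=
  Function.Injective (FreeGroup.lift f) ∧
    ∀ i, ((f i).toWord.length : ℤ) ≤ embeddingLength d

end LatticeSignature

end

/-! Write v for the word f(w_X). Since f is injective on the free group, X is tree-like as soon as v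
is trivial in the free group: a word trivial in a free group is a Dyck word, and a Dyck word has an
explicit height function (`IsLatticePath.isTreeLike`).

A letter is sent to a matrix M with M² = 1. For θ = log (1 + √2) one has cosh θ = √2 and sinh θ = 1,
so exp (θM) = √2 + M. By Chen's identity the projected iterated integrals S_k of v satisfy ∑ θ^k S_k
= `wordMatrix v`, the product of these matrices over the letters (`hasSum_glIteratedIntegral`). If
S_1, …, S_N vanish, then the lower left entry is a tail of a series dominated by y^k / k!, where y ≥
θ |v|; Stirling's bound makes it smaller than 1 in modulus once N + 1 ≥ e y
(`norm_lt_one_of_hasSum`).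

That entry is a Gaussian integer, possibly times √2, so it is 0. On the other hand, the letters act
on the hyperbolic plane by translations that play ping-pong on the four half-planes cut off by an
ideal square, so a nonempty reduced word moves the base point (`halfPlane_of_isReduced`). A zero
entry means that the base point is fixed, hence v is trivial.

Short embeddings come from a second ping-pong: the palindromes over reduced words of length r + 1
with positive first letter, 2 · 3^r in number, are free generators of length 2r + 2. -/

noncomputable section

namespace LatticeSignature

/-! ### Hyperbolic development of words and ping-pong on an ideal square. -/

open Complex ComplexConjugate

/-- The Gaussian integer of a letter: `±1` for the first generator, `±i` for the second. -/
def direction (p : Fin 2 × Bool) : GaussianInt :=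
  (if p.2 then 1 else -1) * (if p.1 = 0 then 1 else ⟨0, 1⟩)

theorem planeToMatrix_step (p : Fin 2 × Bool) :
    planeToMatrix (step p) =
      !![0, (direction p : ℂ); conj (direction p : ℂ), 0] := by
  obtain ⟨i, b⟩ := p
  ext j k
  fin_cases i <;> cases b <;> fin_cases j <;> fin_cases k <;>
    simp [planeToMatrix, step, direction, GaussianInt.toComplex_def]

theorem direction_mul_conj (p : Fin 2 × Bool) :
    (direction p : ℂ) * conj (direction p : ℂ) = 1 := by
  obtain ⟨i, b⟩ := p
  fin_cases i <;> cases b <;> simp [direction, GaussianInt.toComplex_def]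

theorem planeToMatrix_step_mul_self (p : Fin 2 × Bool) :
    planeToMatrix (step p) * planeToMatrix (step p) = 1 := by
  have h := direction_mul_conj p
  have h' := (mul_comm _ _).trans h
  rw [planeToMatrix_step]
  ext j k
  fin_cases j <;> fin_cases k <;> simp [h, h']

/-- The hyperbolic development `cosh θ + sinh θ M` of a letter, for `θ = log (1 + √2)`. -/
def letterMatrix (p : Fin 2 × Bool) : Matrix (Fin 2) (Fin 2) ℂ :=
  (√2 : ℝ) • (1 : Matrix (Fin 2) (Fin 2) ℂ) + planeToMatrix (step p)

/-- The hyperbolic development of a word. -/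
def wordMatrix (w : List (Fin 2 × Bool)) : Matrix (Fin 2) (Fin 2) ℂ :=
  (w.map letterMatrix).prod

theorem step_not {n : ℕ} (i : Fin n) (b : Bool) : step (i, !b) = -step (i, b) := by
  ext j
  by_cases hj : j = i <;> cases b <;> simp [step, hj]

theorem letterMatrix_mul_letterMatrix_not (i : Fin 2) (b : Bool) :
    letterMatrix (i, b) * letterMatrix (i, !b) = 1 := by
  have h : (√2 : ℝ) * √2 = 2 := Real.mul_self_sqrt (by norm_num)
  have h2 := planeToMatrix_step_mul_self (i, b)
  rw [letterMatrix, letterMatrix, step_not, map_neg, add_mul, mul_add, mul_add, mul_neg, mul_neg, h2,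
    smul_mul_smul_comm, h, smul_mul_assoc, mul_smul_comm, one_mul, one_mul, mul_one, two_smul]
  abel

theorem wordMatrix_eq_of_red {v w : List (Fin 2 × Bool)} (h : FreeGroup.Red v w) :
    wordMatrix v = wordMatrix w := by
  induction h with
  | refl => rfl
  | tail _ h ih =>
    rw [ih]
    cases h with
    | not =>
      simp only [wordMatrix, List.map_append, List.map_cons, List.prod_append, List.prod_cons]
      rw [← mul_assoc (letterMatrix _), letterMatrix_mul_letterMatrix_not, one_mul]

theorem wordMatrix_cons_zero (p : Fin 2 × Bool) (w : List (Fin 2 × Bool)) :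
    wordMatrix (p :: w) 0 0 =
      (√2 : ℝ) * wordMatrix w 0 0 + (direction p : ℂ) * wordMatrix w 1 0 := by
  rw [wordMatrix, List.map_cons, List.prod_cons, ← wordMatrix, letterMatrix, planeToMatrix_step,
    Matrix.mul_apply]
  simp

theorem wordMatrix_cons_one (p : Fin 2 × Bool) (w : List (Fin 2 × Bool)) :
    wordMatrix (p :: w) 1 0 =
      conj (direction p : ℂ) * wordMatrix w 0 0 + (√2 : ℝ) * wordMatrix w 1 0 := by
  rw [wordMatrix, List.map_cons, List.prod_cons, ← wordMatrix, letterMatrix, planeToMatrix_step,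
    Matrix.mul_apply]
  simp

/-- The two alternatives are exchanged by each letter, since a letter matrix has √2 on the diagonal
and Gaussian units off it. Thus √2 never mixes with the Gaussian integers inside one entry. -/
theorem wordMatrix_arithmetic (w : List (Fin 2 × Bool)) : ∃ g h : GaussianInt,
    (wordMatrix w 0 0 = (g : ℂ) ∧ wordMatrix w 1 0 = (√2 : ℝ) * (h : ℂ)) ∨
    (wordMatrix w 0 0 = (√2 : ℝ) * (g : ℂ) ∧ wordMatrix w 1 0 = (h : ℂ)) := by
  have h2 : ((√2 : ℝ) : ℂ) * (√2 : ℝ) = 2 := by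
    rw [← Complex.ofReal_mul, Real.mul_self_sqrt (by norm_num)]; simp
  induction w with
  | nil => exact ⟨1, 0, .inl (by simp [wordMatrix])⟩
  | cons p w ih =>
    rw [wordMatrix_cons_zero, wordMatrix_cons_one]
    obtain ⟨g, h, ⟨ha, hb⟩ | ⟨ha, hb⟩⟩ := ih <;> rw [ha, hb]
    · refine ⟨g + direction p * h, star (direction p) * g + 2 * h, .inr ⟨?_, ?_⟩⟩
      · simp only [map_add, map_mul]; ring
      · simp only [map_add, map_mul, GaussianInt.toComplex_star, map_ofNat]
        linear_combination (h : ℂ) * h2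
    · refine ⟨2 * g + direction p * h, star (direction p) * g + h, .inl ⟨?_, ?_⟩⟩
      · simp only [map_add, map_mul, map_ofNat]
        linear_combination (g : ℂ) * h2
      · simp only [map_add, map_mul, GaussianInt.toComplex_star]; ring

theorem gaussianInt_eq_zero_of_norm_lt_one (g : GaussianInt) (h : ‖(g : ℂ)‖ < 1) : g = 0 := by
  have h1 : Complex.normSq (g : ℂ) < 1 := by
    rw [Complex.normSq_eq_norm_sq]; nlinarith [norm_nonneg (g : ℂ)]
  rw [← GaussianInt.intCast_real_norm] at h1
  have h2 : g.norm < 1 := by exact_mod_cast h1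
  have h3 := GaussianInt.norm_nonneg g
  exact GaussianInt.norm_eq_zero.1 (by omega)

theorem wordMatrix_one_zero_eq_zero (w : List (Fin 2 × Bool)) (hw : ‖wordMatrix w 1 0‖ < 1) :
    wordMatrix w 1 0 = 0 := by
  obtain ⟨g, h, ⟨-, hb⟩ | ⟨-, hb⟩⟩ := wordMatrix_arithmetic w <;> rw [hb] at hw ⊢
  · rw [gaussianInt_eq_zero_of_norm_lt_one h]
    · simp
    · rw [norm_mul, Complex.norm_real, Real.norm_of_nonneg (Real.sqrt_nonneg _)] at hw
      have h1 : (1 : ℝ) ≤ √2 := Real.one_le_sqrt.2 (by norm_num)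
      nlinarith [norm_nonneg (h : ℂ)]
  · rw [gaussianInt_eq_zero_of_norm_lt_one h hw]
    simp

/-- Letter matrices lie in SU(1,1), which preserves this Hermitian form. -/
theorem normSq_wordMatrix_sub (w : List (Fin 2 × Bool)) :
    normSq (wordMatrix w 0 0) - normSq (wordMatrix w 1 0) = 1 := by
  have h2 : √2 * √2 = (2 : ℝ) := Real.mul_self_sqrt (by norm_num)
  induction w with
  | nil => simp [wordMatrix]
  | cons p w ih =>
    have hz : (direction p : ℂ).re ^ 2 + (direction p : ℂ).im ^ 2 = 1 := by
      have := congrArg Complex.re (direction_mul_conj p)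
      simp at this; linarith
    rw [wordMatrix_cons_zero, wordMatrix_cons_one]
    generalize wordMatrix w 0 0 = a at *
    generalize wordMatrix w 1 0 = b at *
    generalize (direction p : ℂ) = z at *
    simp only [normSq_apply, add_re, add_im, mul_re, mul_im, ofReal_re, ofReal_im, conj_re,
      conj_im] at ih ⊢
    linear_combination (a.re ^ 2 + a.im ^ 2 - b.re ^ 2 - b.im ^ 2) * h2 +
      (b.re ^ 2 + b.im ^ 2 - a.re ^ 2 - a.im ^ 2) * hz + ih

/-- The half-plane of a direction `z`, in the hyperboloid model. -/
def HalfPlane (z a b : ℂ) : Prop := normSq a + normSq b < 2 * √2 * (z * b * conj a).re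

/-- In the Klein disk, at the point 2bā / (|a|² + |b|²), `HalfPlane z` is the cap beyond the chord
at distance 1/√2 = tanh θ from the centre, in the direction of conj z. The letter translates by 2θ
along this diameter, so it carries the chord at −tanh θ to the one at tanh θ. The hypothesis says
that the point is off the closed opposite cap. -/
theorem halfPlane_step {z a b : ℂ} (hz : z * conj z = 1)
    (h : 0 < normSq a + normSq b + 2 * √2 * (z * b * conj a).re) :
    HalfPlane z ((√2 : ℝ) * a + z * b) (conj z * a + (√2 : ℝ) * b) := by
  have h2 : √2 * √2 = (2 : ℝ) := Real.mul_self_sqrt (by norm_num)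
  have hz : z.re ^ 2 + z.im ^ 2 = 1 := by
    have := congrArg Complex.re hz
    simp at this; linarith
  -- The coefficients are those of the boost by 2θ: cosh 2θ = 3 and sinh 2θ = 2√2.
  have key1 : normSq ((√2 : ℝ) * a + z * b) + normSq (conj z * a + (√2 : ℝ) * b) =
      3 * (normSq a + normSq b) + 4 * √2 * (z * b * conj a).re := by
    simp only [normSq_apply, add_re, add_im, mul_re, mul_im, ofReal_re, ofReal_im, conj_re,
      conj_im]
    linear_combination (a.re ^ 2 + a.im ^ 2 + b.re ^ 2 + b.im ^ 2) * h2 +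
      (b.re ^ 2 + b.im ^ 2 + a.re ^ 2 + a.im ^ 2) * hz
  have key2 : (z * (conj z * a + (√2 : ℝ) * b) * conj ((√2 : ℝ) * a + z * b)).re =
      √2 * (normSq a + normSq b) + 3 * (z * b * conj a).re := by
    simp only [normSq_apply, add_re, add_im, mul_re, mul_im, ofReal_re, ofReal_im, conj_re,
      conj_im]
    linear_combination (a.re*b.re*z.re - a.re*b.im*z.im + a.im*b.re*z.im + a.im*b.im*z.re) * h2 +
      (√2 * (b.re ^ 2 + b.im ^ 2 + a.re ^ 2 + a.im ^ 2) +
      (a.re*b.re*z.re - a.re*b.im*z.im + a.im*b.re*z.im + a.im*b.im*z.re)) * hz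
  rw [HalfPlane, key1, key2]
  linear_combination h - (2 * (normSq a + normSq b)) * h2

/-- Chords of orthogonal directions meet only on the unit circle. Algebraically, with T = |a|² +
|b|², adding the two squared inequalities gives 2T² ≤ 8|a|²|b|², whereas T² − 4|a|²|b|² = 1. -/
theorem not_halfPlane_two {x y : ℝ} {a b : ℂ} (hab : normSq a - normSq b = 1)
    (hxy : x ^ 2 + y ^ 2 = normSq a * normSq b) (hx : normSq a + normSq b < 2 * √2 * x)
    (hy : normSq a + normSq b ≤ 2 * √2 * y) : False := by
  have h2 : √2 * √2 = (2 : ℝ) := Real.mul_self_sqrt (by norm_num)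
  have ha := normSq_nonneg a
  have hb := normSq_nonneg b
  have e1 : (normSq a + normSq b) ^ 2 ≤ (2 * √2 * x) ^ 2 := by gcongr
  have e2 : (normSq a + normSq b) ^ 2 ≤ (2 * √2 * y) ^ 2 := by gcongr
  nlinarith

/-- The half-plane of q misses the closed half-plane opposite to p unless q is the inverse of p.
Equal letters give opposite caps; the other cases are orthogonal directions, one instance of
`not_halfPlane_two` per choice of axes and signs. -/
theorem halfPlane_separated {p q : Fin 2 × Bool} {a b : ℂ} (hab : normSq a - normSq b = 1)
    (hpq : p.1 = q.1 → p.2 = q.2) (hq : HalfPlane (direction q) a b) :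
    0 < normSq a + normSq b + 2 * √2 * ((direction p : ℂ) * b * conj a).re := by
  have h1 : 0 < normSq a + normSq b := by linarith [normSq_nonneg b]
  have hxy : ((b * conj a).re) ^ 2 + ((b * conj a).im) ^ 2 = normSq a * normSq b := by
    rw [mul_comm (normSq a), ← normSq_conj a, ← map_mul, normSq_apply]; ring
  generalize hc : b * conj a = c at hxy
  rw [HalfPlane] at hq
  rw [mul_assoc (direction _ : ℂ), hc] at hq ⊢
  have e := not_halfPlane_two hab (x := c.re) (y := c.im) (by linarith)
  have e1 := not_halfPlane_two hab (x := c.re) (y := -c.im) (by linarith)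
  have e2 := not_halfPlane_two hab (x := -c.re) (y := c.im) (by linarith)
  have e3 := not_halfPlane_two hab (x := -c.re) (y := -c.im) (by linarith)
  have f := not_halfPlane_two hab (x := c.im) (y := c.re) (by linarith)
  have f1 := not_halfPlane_two hab (x := c.im) (y := -c.re) (by linarith)
  have f2 := not_halfPlane_two hab (x := -c.im) (y := c.re) (by linarith)
  have f3 := not_halfPlane_two hab (x := -c.im) (y := -c.re) (by linarith)
  by_contra! hcon
  obtain ⟨i, s⟩ := p
  obtain ⟨j, t⟩ := q
  fin_cases i <;> fin_cases j <;> cases s <;> cases t <;>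
    simp [direction, GaussianInt.toComplex_def] at hpq hq hcon <;>
    first
      | linarith
      | exact e (by linarith) (by linarith)
      | exact e1 (by linarith) (by linarith)
      | exact e2 (by linarith) (by linarith)
      | exact e3 (by linarith) (by linarith)
      | exact f (by linarith) (by linarith)
      | exact f1 (by linarith) (by linarith)
      | exact f2 (by linarith) (by linarith)
      | exact f3 (by linarith) (by linarith)

theorem halfPlane_of_isReduced (w : List (Fin 2 × Bool)) :
    ∀ p, FreeGroup.IsReduced (p :: w) →
      HalfPlane (direction p) (wordMatrix (p :: w) 0 0) (wordMatrix (p :: w) 1 0) := by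
  induction w with
  | nil =>
    intro p _
    rw [wordMatrix_cons_zero, wordMatrix_cons_one]
    exact halfPlane_step (direction_mul_conj p) (by simp [wordMatrix])
  | cons q w ih =>
    intro p hp
    rw [FreeGroup.isReduced_cons_cons] at hp
    rw [wordMatrix_cons_zero p, wordMatrix_cons_one p]
    exact halfPlane_step (direction_mul_conj p)
      (halfPlane_separated (normSq_wordMatrix_sub _) hp.1 (ih q hp.2))

/-- Discreteness turns a small entry into a zero one. The centre of the disk lies in none of the
half-planes, so the reduced word has no first letter. -/
theorem mk_eq_one_of_norm_wordMatrix_lt_one (w : List (Fin 2 × Bool))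
    (hw : ‖wordMatrix w 1 0‖ < 1) : FreeGroup.mk w = 1 := by
  rw [← FreeGroup.toWord_eq_nil_iff, FreeGroup.toWord_mk]
  have h0 := wordMatrix_one_zero_eq_zero w hw
  rw [wordMatrix_eq_of_red FreeGroup.reduce.red] at h0
  rcases hr : FreeGroup.reduce w with _ | ⟨p, v⟩
  · rfl
  · exfalso
    have h1 : FreeGroup.IsReduced (p :: v) := by
      rw [← hr, ← FreeGroup.toWord_mk]; exact FreeGroup.isReduced_toWord
    have h2 := halfPlane_of_isReduced v p h1
    rw [hr] at h0
    rw [HalfPlane, h0] at h2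
    simp only [map_zero, mul_zero, zero_mul, Complex.zero_re, add_zero] at h2
    exact absurd h2 (not_lt.2 (normSq_nonneg _))

end LatticeSignature

end

/-! ### Short embeddings from palindromes. -/

noncomputable section

namespace LatticeSignature

open FreeGroup

/-- Fewer than k letters of A can cancel against h, so all but the last k − 1 letters survive. The
induction strips the last letter of A: either it cancels and k drops by one, or nothing cancels at
all. -/
theorem prefix_toWord_mk_mul {α : Type*} [DecidableEq α] (A : List (α × Bool)) :
    ∀ (k : ℕ) (h : FreeGroup α), IsReduced A → 1 ≤ k → k ≤ A.length →
      ¬ (invRev A).take k <+: h.toWord → A.take (A.length - k + 1) <+: (mk A * h).toWord := by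
  induction A using List.reverseRecOn with
  | nil => intro k h _ h1 h2; simp at h2; omega
  | append_singleton A x ih =>
    intro k h hA h1 h2 hk
    have hinv : invRev (A ++ [x]) = (x.1, !x.2) :: invRev A := by simp [invRev]
    rw [hinv] at hk
    have hred : IsReduced h.toWord := isReduced_toWord
    have hh : h = mk h.toWord := mk_toWord.symm
    by_cases hx : ∃ t, h.toWord = (x.1, !x.2) :: t
    · obtain ⟨t, ht⟩ := hx
      rw [ht] at hk hred hh
      have hmul : mk (A ++ [x]) * h = mk A * mk t := by
        have : mk [x] * h = mk t := by
          rw [hh, mul_mk]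
          exact Quot.sound (by simpa using Red.Step.not (L₁ := []) (L₂ := t) (x := x.1) (b := x.2))
        rw [← mul_mk, mul_assoc, this]
      have htr : IsReduced t := hred.infix ⟨[(x.1, !x.2)], [], by simp⟩
      have ht' : (mk t).toWord = t := by rw [toWord_mk, htr.reduce_eq]
      obtain ⟨k, rfl⟩ : ∃ m, k = m + 1 := ⟨k - 1, by omega⟩
      rw [List.take_succ_cons, List.cons_prefix_cons] at hk
      have hk' : ¬ (invRev A).take k <+: t := fun hc => hk ⟨rfl, hc⟩
      have hk1 : 1 ≤ k := by
        rcases Nat.eq_zero_or_pos k with rfl | h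
        · simp at hk'
        · exact h
      rw [List.length_append, List.length_singleton] at h2 ⊢
      have := ih k (mk t) (hA.infix ⟨[], [x], by simp⟩) hk1 (by omega) (by rwa [ht'])
      rw [hmul]
      rw [List.take_append_of_le_length (by omega)]
      convert this using 2
      omega
    · have hr : IsReduced (A ++ [x] ++ h.toWord) := by
        refine IsReduced.append_overlap hA ?_ (by simp)
        rcases ht : h.toWord with _ | ⟨y, t⟩
        · simp
        · rw [List.singleton_append, isReduced_cons_cons]
          refine ⟨fun h1 => ?_, ht ▸ hred⟩
          by_contra h2
          refine hx ⟨t, ?_⟩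
          rw [ht, ← Bool.eq_not_of_ne (Ne.symm h2), h1]
      have : (mk (A ++ [x]) * h).toWord = A ++ [x] ++ h.toWord := by
        conv_lhs => rw [hh, mul_mk, toWord_mk, hr.reduce_eq]
      rw [this]
      exact (List.take_prefix _ _).trans (List.prefix_append _ _)

theorem isReduced_append_reverse {α : Type*} {u : List (α × Bool)} (hu : IsReduced u) :
    IsReduced (u ++ u.reverse) := by
  refine List.isChain_append.2 ⟨hu, ?_, ?_⟩
  · rw [List.isChain_reverse]
    exact List.IsChain.imp (fun a b h e => (h e.symm).symm) hu
  · intro x hx y hy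
    rw [List.head?_reverse] at hy
    rw [Option.mem_unique hx hy]
    exact fun _ => rfl

/-- The group elements of the palindromes over reduced words of one length, all of them starting
with a positive letter, are free generators. -/
theorem injective_lift_palindrome {α : Type*} [DecidableEq α] (n : ℕ)
    (S : Finset (List (α × Bool))) (hn : 1 ≤ n) (hS : 1 < S.card)
    (hred : ∀ u ∈ S, IsReduced u) (hlen : ∀ u ∈ S, u.length = n)
    (hpos : ∀ u ∈ S, ∀ p ∈ u.head?, p.2 = true) :
    Function.Injective (FreeGroup.lift fun u : S => mk ((u : List (α × Bool)) ++ u.1.reverse)) := by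
  have : Nontrivial S := Fintype.one_lt_card_iff_nontrivial.1 (by simpa using hS)
  let neg : List (α × Bool) → List (α × Bool) := List.map fun p => (p.1, !p.2)
  have hneg : Function.Injective neg := List.map_injective_iff.2 fun p q h => by
    simp only [Prod.mk.injEq, Bool.not_inj_iff] at h
    exact Prod.ext h.1 h.2
  have hinv : ∀ u : List (α × Bool), invRev (u ++ u.reverse) = neg u ++ (neg u).reverse := by
    intro u; simp [invRev, neg]
  have hpre : ∀ {u v w : List (α × Bool)}, u <+: w → v <+: w → u.length = v.length → u = v :=
    fun h1 h2 h3 => (List.prefix_of_prefix_length_le h1 h2 h3.le).eq_of_length h3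
  -- The attracting set of a generator is given by the prefix u, that of its inverse by the prefix
  -- with all signs flipped: inverting a palindrome only flips the signs of its letters.
  refine FreeGroup.injective_lift_of_ping_pong _
    (fun u : S => {h : FreeGroup α | u.1 <+: h.toWord})
    (fun u : S => {h : FreeGroup α | neg u.1 <+: h.toWord}) ?_ ?_ ?_ ?_ ?_ ?_
  · rintro ⟨u, hu⟩
    exact ⟨mk u, by simp [toWord_mk, (hred u hu).reduce_eq]⟩
  · rintro ⟨u, hu⟩ ⟨v, hv⟩ huv
    refine Set.disjoint_left.2 fun h h1 h2 => huv (Subtype.ext ?_)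
    exact hpre h1 h2 ((hlen u hu).trans (hlen v hv).symm)
  · rintro ⟨u, hu⟩ ⟨v, hv⟩ huv
    refine Set.disjoint_left.2 fun h h1 h2 => huv (Subtype.ext (hneg ?_))
    exact hpre h1 h2 (by simp [neg, hlen u hu, hlen v hv])
  · rintro ⟨u, hu⟩ ⟨v, hv⟩
    refine Set.disjoint_left.2 fun h h1 h2 => ?_
    -- Impossible, since u and v both start with a positive letter.
    have huv : u = neg v := hpre h1 h2 (by simp [neg, hlen u hu, hlen v hv])
    have hv1 := hpos v hv
    have hu1 := hpos u hu
    have := hlen v hv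
    rcases v with _ | ⟨p, v⟩
    · simp at this; omega
    · simp [huv, neg] at hu1
      simp [hu1] at hv1
  · rintro ⟨u, hu⟩ _ ⟨h, hh, rfl⟩
    -- With k = n, at least n + 1 of the 2n letters survive, in particular all of u.
    have key := prefix_toWord_mk_mul (u ++ u.reverse) n h (isReduced_append_reverse (hred u hu)) hn
      (by simp [hlen u hu])
    rw [hinv, List.take_append_of_le_length (by simp [neg, hlen u hu]),
      List.take_of_length_le (by simp [neg, hlen u hu])] at key
    refine List.IsPrefix.trans ?_ (key hh)
    exact List.prefix_take_iff.2 ⟨List.prefix_append _ _, by simp [hlen u hu]⟩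
  · rintro ⟨u, hu⟩ _ ⟨h, hh, rfl⟩
    have hr : IsReduced (invRev (u ++ u.reverse)) := by
      rw [isReduced_iff_reduce_eq, reduce_invRev, (isReduced_append_reverse (hred u hu)).reduce_eq]
    have key := prefix_toWord_mk_mul (invRev (u ++ u.reverse)) n h hr hn (by simp [hlen u hu])
    rw [invRev_invRev, List.take_append_of_le_length (by simp [hlen u hu]),
      List.take_of_length_le (by simp [hlen u hu])] at key
    refine List.IsPrefix.trans ?_ (key hh)
    refine List.prefix_take_iff.2 ⟨?_, by simp [neg, hlen u hu]⟩
    rw [hinv]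
    exact List.prefix_append _ _

/-- Each letter of a reduced word can be followed by any of three letters. -/
theorem exists_finset_reduced_words (p : Fin 2 × Bool) (r : ℕ) :
    ∃ S : Finset (List (Fin 2 × Bool)), S.card = 3 ^ r ∧
      ∀ u ∈ S, IsReduced u ∧ u.length = r + 1 ∧ u.head? = some p := by
  induction r generalizing p with
  | zero => exact ⟨{[p]}, by simp, by simp⟩
  | succ r ih =>
    choose S hcard hS using ih
    refine ⟨(Finset.univ.erase (p.1, !p.2)).biUnion fun q => (S q).image (List.cons p), ?_, ?_⟩
    · rw [Finset.card_biUnion]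
      · simp only [Finset.card_image_of_injective _ (List.cons_injective), hcard, Finset.sum_const,
          Finset.card_erase_of_mem (Finset.mem_univ _), Finset.card_univ, Fintype.card_prod,
          Fintype.card_fin, Fintype.card_bool, smul_eq_mul]
        ring
      · intro q _ q' _ hqq
        refine Finset.disjoint_left.2 fun u h1 h2 => hqq ?_
        obtain ⟨v, hv, rfl⟩ := Finset.mem_image.1 h1
        obtain ⟨v', hv', h⟩ := Finset.mem_image.1 h2
        obtain rfl := (List.cons.inj h).2
        exact Option.some.inj ((hS q _ hv).2.2.symm.trans (hS q' _ hv').2.2)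
    · intro u hu
      obtain ⟨q, hq, hu⟩ := Finset.mem_biUnion.1 hu
      obtain ⟨v, hv, rfl⟩ := Finset.mem_image.1 hu
      obtain ⟨h1, h2, h3⟩ := hS q v hv
      refine ⟨?_, by simp [h2], rfl⟩
      rcases v with _ | ⟨y, v⟩
      · simp
      · obtain rfl : y = q := by simpa using h3
        refine isReduced_cons_cons.2 ⟨fun h => ?_, h1⟩
        by_contra hne
        refine (Finset.mem_erase.1 hq).1 ?_
        rw [h, ← Bool.eq_not_of_ne (Ne.symm hne)]

theorem exists_isShortEmbedding (d : ℕ) (hd : 1 ≤ d) :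
    ∃ f : Fin d → FreeGroup (Fin 2), IsShortEmbedding f := by
  have hd' : (1 : ℝ) ≤ d := by exact_mod_cast hd
  have hnn : 0 ≤ ⌈Real.logb 3 ((d : ℝ) / 2)⌉ := by
    -- The logarithm is negative for d = 1, but it exceeds −1, so its ceiling is still a natural
    -- number.
    have : Real.logb 3 (1 / 3) < Real.logb 3 ((d : ℝ) / 2) :=
      Real.logb_lt_logb (by norm_num) (by norm_num) (by linarith)
    rw [one_div, Real.logb_inv, Real.logb_self_eq_one (by norm_num)] at this
    have h : (-1 : ℤ) < ⌈Real.logb 3 ((d : ℝ) / 2)⌉ := Int.lt_ceil.2 (by simpa using this)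
    omega
  obtain ⟨r, hr⟩ := Int.eq_ofNat_of_zero_le hnn
  have hdr : d ≤ 2 * 3 ^ r := by
    have h1 : Real.logb 3 ((d : ℝ) / 2) ≤ r := by
      have := Int.le_ceil (Real.logb 3 ((d : ℝ) / 2))
      rw [hr] at this; exact_mod_cast this
    rw [Real.logb_le_iff_le_rpow (by norm_num) (by linarith), Real.rpow_natCast] at h1
    have h2 : (d : ℝ) ≤ 2 * 3 ^ r := by linarith
    exact_mod_cast h2
  obtain ⟨S₀, hc₀, hS₀⟩ := exists_finset_reduced_words (0, true) r
  obtain ⟨S₁, hc₁, hS₁⟩ := exists_finset_reduced_words (1, true) r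
  have hcard : (S₀ ∪ S₁).card = 2 * 3 ^ r := by
    rw [Finset.card_union_of_disjoint, hc₀, hc₁, two_mul]
    refine Finset.disjoint_left.2 fun u h0 h1 => ?_
    have := (hS₀ u h0).2.2.symm.trans (hS₁ u h1).2.2
    simp at this
  have hS : ∀ u ∈ S₀ ∪ S₁, IsReduced u ∧ u.length = r + 1 ∧ ∀ p ∈ u.head?, p.2 = true := by
    intro u hu
    rcases Finset.mem_union.1 hu with h | h
    · exact ⟨(hS₀ u h).1, (hS₀ u h).2.1, by simp [(hS₀ u h).2.2]⟩
    · exact ⟨(hS₁ u h).1, (hS₁ u h).2.1, by simp [(hS₁ u h).2.2]⟩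
  have hinj := injective_lift_palindrome (r + 1) (S₀ ∪ S₁) (by omega)
    (by rw [hcard]; have := Nat.one_le_pow r 3 (by norm_num); omega)
    (fun u hu => (hS u hu).1) (fun u hu => (hS u hu).2.1) (fun u hu => (hS u hu).2.2)
  obtain ⟨e⟩ : Nonempty (Fin d ↪ (S₀ ∪ S₁ : Finset _)) :=
    Function.Embedding.nonempty_of_card_le (by simpa [hcard] using hdr)
  refine ⟨fun i => mk ((e i).1 ++ (e i).1.reverse), ?_, fun i => ?_⟩
  · have : FreeGroup.lift (fun i => mk ((e i).1 ++ (e i).1.reverse)) =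
        (FreeGroup.lift fun u : (S₀ ∪ S₁ : Finset _) => mk (u.1 ++ u.1.reverse)).comp
          (FreeGroup.map e) := by
      ext i; simp
    rw [this, MonoidHom.coe_comp]
    exact hinj.comp (FreeGroup.map_injective e.injective)
  · rw [toWord_mk, (isReduced_append_reverse (hS _ (e i).2).1).reduce_eq, embeddingLength, hr]
    simp [(hS _ (e i).2).2.1]
    omega

end LatticeSignature

end

/-! ### From trivial words to tree-like paths. -/

noncomputable section

namespace LatticeSignature

/-- Words obtained from the empty word by concatenation and by enclosing a word between a letter
and its inverse. -/
inductive IsDyckWord {α : Type*} : List (α × Bool) → Prop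
  | nil : IsDyckWord []
  | append {v w : List (α × Bool)} : IsDyckWord v → IsDyckWord w → IsDyckWord (v ++ w)
  | wrap (a : α) (b : Bool) {w : List (α × Bool)} :
      IsDyckWord w → IsDyckWord ((a, b) :: (w ++ [(a, !b)]))

theorem IsDyckWord.insert {α : Type*} {w : List (α × Bool)} (hw : IsDyckWord w) (a : α) (b : Bool) :
    ∀ v₁ v₂, w = v₁ ++ v₂ → IsDyckWord (v₁ ++ (a, b) :: (a, !b) :: v₂) := by
  have hpair : IsDyckWord [(a, b), (a, !b)] := .wrap a b .nil
  induction hw with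
  | nil =>
    intro v₁ v₂ h
    obtain ⟨rfl, rfl⟩ := List.append_eq_nil_iff.1 h.symm
    exact hpair
  | @append v w hv hw ihv ihw =>
    intro v₁ v₂ h
    rcases List.append_eq_append_iff.1 h with ⟨u, rfl, rfl⟩ | ⟨u, rfl, rfl⟩
    · simpa using hv.append (ihw _ _ rfl)
    · simpa using (ihv _ _ rfl).append hw
  | @wrap c s w hw ih =>
    intro v₁ v₂ h
    rcases v₁ with _ | ⟨x, v₁⟩
    · rw [List.nil_append] at h ⊢
      rw [← h]
      exact hpair.append (hw.wrap c s)
    · rw [List.cons_append, List.cons.injEq] at h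
      obtain ⟨rfl, h⟩ := h
      rcases List.eq_nil_or_concat v₂ with rfl | ⟨v₂, y, rfl⟩
      · rw [List.append_nil] at h
        rw [← h]
        simpa using (hw.wrap c s).append hpair
      · rw [List.concat_eq_append, ← List.append_assoc] at h
        obtain ⟨rfl, hy⟩ := List.append_inj' h rfl
        obtain rfl := (List.cons.inj hy).1
        simpa using (ih _ _ rfl).wrap c s

/-- Read backwards, a reduction to the empty word inserts cancelling pairs one at a time, and Dyck
words are stable under such insertions. -/
theorem isDyckWord_of_mk_eq_one {α : Type*} {w : List (α × Bool)} (h : FreeGroup.mk w = 1) :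
    IsDyckWord w := by
  have hr : FreeGroup.Red w [] := by
    obtain ⟨c, h1, h2⟩ := FreeGroup.Red.exact.1 (h.trans FreeGroup.one_eq_mk)
    rwa [FreeGroup.Red.nil_iff.1 h2] at h1
  clear h
  induction hr using Relation.ReflTransGen.head_induction_on with
  | refl => exact .nil
  | head h _ ih =>
    cases h with
    | not => exact ih.insert _ _ _ _ rfl

theorem norm_step {n : ℕ} (p : Fin n × Bool) : ‖step p‖ = 1 := by
  obtain ⟨i, b⟩ := p
  cases b <;> simp [step]

theorem latticePath_append {n : ℕ} (v w : List (Fin n × Bool)) (t : ℝ) :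
    latticePath (v ++ w) t = latticePath v t + latticePath w (t - v.length) := by
  rw [latticePath, latticePath, latticePath]
  rw [← Fin.sum_congr' (fun k => max 0 (min 1 (t - (k : ℕ))) • step ((v ++ w).get k))
    (List.length_append (as := v) (bs := w)).symm, Fin.sum_univ_add]
  congr 1
  · simp
  · refine Finset.sum_congr rfl fun k _ => ?_
    simp [sub_sub]

theorem latticePath_singleton {n : ℕ} (p : Fin n × Bool) (t : ℝ) :
    latticePath [p] t = max 0 (min 1 t) • step p := by
  simp [latticePath]

theorem latticePath_cons {n : ℕ} (p : Fin n × Bool) (w : List (Fin n × Bool)) (t : ℝ) :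
    latticePath (p :: w) t = max 0 (min 1 t) • step p + latticePath w (t - 1) := by
  simpa [latticePath_singleton] using latticePath_append [p] w t

theorem latticePath_nil {n : ℕ} (t : ℝ) : latticePath ([] : List (Fin n × Bool)) t = 0 := by
  simp [latticePath]

theorem latticePath_of_nonpos {n : ℕ} (w : List (Fin n × Bool)) {t : ℝ} (ht : t ≤ 0) :
    latticePath w t = 0 := by
  refine Finset.sum_eq_zero fun k _ => ?_
  rw [max_eq_left, zero_smul]
  have : (0 : ℝ) ≤ (k : ℕ) := by positivity
  exact (min_le_right _ _).trans (by linarith)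

theorem latticePath_of_length_le {n : ℕ} (w : List (Fin n × Bool)) {t : ℝ} (ht : w.length ≤ t) :
    latticePath w t = latticePath w w.length := by
  refine Finset.sum_congr rfl fun k _ => ?_
  have : ((k : ℕ) : ℝ) + 1 ≤ w.length := by exact_mod_cast k.2
  rw [min_eq_left (by linarith), min_eq_left (by linarith)]

/-- A height function for the path of a word, defined on the whole line and vanishing outside of
the time interval of the path. -/
structure IsHeight {n : ℕ} (w : List (Fin n × Bool)) (h : ℝ → ℝ) : Prop where
  continuous : Continuous h
  nonneg : ∀ t, 0 ≤ h t
  eq_zero_of_nonpos : ∀ t ≤ 0, h t = 0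
  eq_zero_of_length_le : ∀ t : ℝ, w.length ≤ t → h t = 0
  exists_norm_sub_le : ∀ s t : ℝ, 0 ≤ s → s ≤ t → t ≤ w.length → ∃ u, s ≤ u ∧ u ≤ t ∧
    ‖latticePath w t - latticePath w s‖ ≤ h s + h t - 2 * h u

theorem IsHeight.norm_latticePath_le {n : ℕ} {w : List (Fin n × Bool)} {h : ℝ → ℝ}
    (hw : IsHeight w h) {t : ℝ} (h0 : 0 ≤ t) (h1 : t ≤ w.length) : ‖latticePath w t‖ ≤ h t := by
  obtain ⟨u, -, -, hu⟩ := hw.exists_norm_sub_le 0 t le_rfl h0 h1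
  rw [latticePath_of_nonpos w le_rfl, sub_zero, hw.eq_zero_of_nonpos 0 le_rfl] at hu
  linarith [hw.nonneg u]

theorem IsHeight.latticePath_length {n : ℕ} {w : List (Fin n × Bool)} {h : ℝ → ℝ}
    (hw : IsHeight w h) : latticePath w w.length = 0 := by
  have := hw.norm_latticePath_le (t := w.length) (by positivity) le_rfl
  rw [hw.eq_zero_of_length_le _ le_rfl] at this
  exact norm_le_zero_iff.1 this

/-- Both paths are loops, and each height vanishes outside its own time interval. When s and t lie
on different sides of the junction, the junction itself is the required u, at height 0. -/
theorem IsHeight.append {n : ℕ} {v w : List (Fin n × Bool)} {h k : ℝ → ℝ}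
    (hv : IsHeight v h) (hw : IsHeight w k) :
    IsHeight (v ++ w) fun t => h t + k (t - v.length) := by
  have hl : (0 : ℝ) ≤ v.length := by positivity
  have hl' : (0 : ℝ) ≤ w.length := by positivity
  refine ⟨hv.continuous.add (hw.continuous.comp (by fun_prop)),
    fun t => add_nonneg (hv.nonneg _) (hw.nonneg _), fun t ht => ?_, fun t ht => ?_, ?_⟩
  · rw [hv.eq_zero_of_nonpos t ht, hw.eq_zero_of_nonpos _ (by linarith), add_zero]
  · rw [List.length_append, Nat.cast_add] at ht
    rw [hv.eq_zero_of_length_le t (by linarith), hw.eq_zero_of_length_le _ (by linarith), add_zero]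
  · intro s t hs hst ht
    rw [List.length_append, Nat.cast_add] at ht
    simp only [latticePath_append]
    rcases le_total t v.length with h1 | h1
    · obtain ⟨u, hsu, hut, hu⟩ := hv.exists_norm_sub_le s t hs hst h1
      refine ⟨u, hsu, hut, ?_⟩
      rw [latticePath_of_nonpos w (t := t - _) (by linarith),
        latticePath_of_nonpos w (t := s - _) (by linarith), hw.eq_zero_of_nonpos _ (by linarith),
        hw.eq_zero_of_nonpos _ (by linarith), hw.eq_zero_of_nonpos _ (by linarith)]
      simpa using hu
    · rw [latticePath_of_length_le v h1, hv.latticePath_length, hv.eq_zero_of_length_le t h1]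
      rcases le_total s v.length with h2 | h2
      · refine ⟨v.length, h2, h1, ?_⟩
        rw [latticePath_of_nonpos w (t := s - _) (by linarith),
          hw.eq_zero_of_nonpos (s - _) (by linarith), hv.eq_zero_of_length_le _ le_rfl,
          hw.eq_zero_of_nonpos (v.length - v.length) (by simp)]
        have e1 := hv.norm_latticePath_le hs h2
        have e2 := hw.norm_latticePath_le (t := t - v.length) (by linarith) (by linarith)
        calc _ = ‖latticePath w (t - v.length) - latticePath v s‖ := by simp
          _ ≤ _ := norm_sub_le _ _
          _ ≤ _ := by linarith
      · obtain ⟨u, hsu, hut, hu⟩ := hw.exists_norm_sub_le (s - v.length) (t - v.length)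
          (by linarith) (by linarith) (by linarith)
        refine ⟨u + v.length, by linarith, by linarith, ?_⟩
        rw [latticePath_of_length_le v h2, hv.latticePath_length, hv.eq_zero_of_length_le s h2,
          hv.eq_zero_of_length_le (u + _) (by linarith)]
        simpa using hu

/-- The added trapezoid rises during the first letter, stays at 1 during the inner word and falls
during the last letter. Only when s and t are both in the middle stage is u taken from the inner
height; otherwise an endpoint serves. -/
theorem IsHeight.wrap {n : ℕ} {w : List (Fin n × Bool)} {h : ℝ → ℝ} (hw : IsHeight w h)
    (a : Fin n) (b : Bool) :
    IsHeight ((a, b) :: (w ++ [(a, !b)])) fun t =>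
      max 0 (min 1 (min t (w.length + 2 - t))) + h (t - 1) := by
  have hl : (0 : ℝ) ≤ w.length := by positivity
  have hlen : (((a, b) :: (w ++ [(a, !b)])).length : ℝ) = w.length + 2 := by
    simp; ring
  refine ⟨Continuous.add (by fun_prop) (hw.continuous.comp (by fun_prop)),
    fun t => add_nonneg (le_max_left _ _) (hw.nonneg _), fun t ht => ?_, fun t ht => ?_, ?_⟩
  · rw [hw.eq_zero_of_nonpos _ (by linarith), max_eq_left, add_zero]
    exact (min_le_right _ _).trans ((min_le_left _ _).trans ht)
  · rw [hlen] at ht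
    rw [hw.eq_zero_of_length_le _ (by linarith), max_eq_left, add_zero]
    exact (min_le_right _ _).trans ((min_le_right _ _).trans (by linarith))
  · rw [hlen]
    set X := latticePath ((a, b) :: (w ++ [(a, !b)]))
    set k : ℝ → ℝ := fun t => max 0 (min 1 (min t (w.length + 2 - t))) + h (t - 1)
    have hX : ∀ t, X t = max 0 (min 1 t) • step (a, b) + (latticePath w (t - 1) +
        max 0 (min 1 (t - 1 - w.length)) • -step (a, b)) := fun t => by
      simp only [X]
      rw [latticePath_cons, latticePath_append, latticePath_singleton, step_not]
    have hX1 : ∀ t : ℝ, 0 ≤ t → t ≤ 1 → X t = t • step (a, b) ∧ k t = t := by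
      intro t h0 h1
      constructor
      · rw [hX, latticePath_of_nonpos w (by linarith), min_eq_right h1, max_eq_right h0,
          min_eq_right (by linarith), max_eq_left (by linarith)]
        simp
      · simp only [k]
        rw [hw.eq_zero_of_nonpos _ (by linarith), min_eq_left (a := t) (by linarith), min_eq_right h1,
          max_eq_right h0, add_zero]
    have hX2 : ∀ t : ℝ, 1 ≤ t → t ≤ w.length + 1 →
        X t = step (a, b) + latticePath w (t - 1) ∧ k t = 1 + h (t - 1) := by
      intro t h0 h1
      constructor
      · rw [hX, min_eq_left h0, max_eq_right zero_le_one, min_eq_right (by linarith),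
          max_eq_left (by linarith)]
        simp
      · simp only [k]
        rw [min_eq_left (le_min h0 (by linarith)), max_eq_right zero_le_one]
    have hX3 : ∀ t : ℝ, w.length + 1 ≤ t → t ≤ w.length + 2 →
        X t = (w.length + 2 - t) • step (a, b) ∧ k t = w.length + 2 - t := by
      intro t h0 h1
      constructor
      · rw [hX, latticePath_of_length_le w (by linarith), hw.latticePath_length,
          min_eq_left (by linarith), max_eq_right zero_le_one, min_eq_right (by linarith),
          max_eq_right (by linarith)]
        module
      · simp only [k]
        rw [hw.eq_zero_of_length_le _ (by linarith), min_eq_right (b := _ - t) (by linarith),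
          min_eq_right (by linarith), max_eq_right (by linarith), add_zero]
    have hsm : ∀ r r' : ℝ, ‖r • step (a, b) - r' • step (a, b)‖ = |r - r'| := by
      intro r r'
      rw [← sub_smul, norm_smul, norm_step, mul_one, Real.norm_eq_abs]
    have hmid : ∀ t r : ℝ, 1 ≤ t → t ≤ w.length + 1 → r ≤ 1 →
        ‖X t - r • step (a, b)‖ ≤ k t - r := by
      intro t r h1 h2 hr
      rw [(hX2 t h1 h2).1, (hX2 t h1 h2).2]
      calc _ = ‖(1 - r) • step (a, b) + latticePath w (t - 1)‖ := by congr 1; module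
        _ ≤ _ := norm_add_le _ _
        _ ≤ (1 - r) + h (t - 1) := by
          rw [norm_smul, norm_step, mul_one, Real.norm_of_nonneg (by linarith)]
          gcongr
          exact hw.norm_latticePath_le (by linarith) (by linarith)
        _ = _ := by ring
    suffices H : ∀ s t : ℝ, 0 ≤ s → s ≤ t → t ≤ w.length + 2 → ∃ u, s ≤ u ∧ u ≤ t ∧
        ‖X t - X s‖ ≤ k s + k t - 2 * k u from H
    intro s t hs hst ht
    rcases le_total s 1 with s1 | s1
    · obtain ⟨hs1, hs2⟩ := hX1 s hs s1
      rcases le_total t 1 with t1 | t1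
      · obtain ⟨ht1, ht2⟩ := hX1 t (by linarith) t1
        refine ⟨s, le_rfl, hst, ?_⟩
        rw [hs1, hs2, ht1, ht2, hsm, abs_of_nonneg (by linarith)]
        linarith
      rcases le_total t (w.length + 1) with t2 | t2
      · refine ⟨s, le_rfl, hst, ?_⟩
        rw [hs1, hs2]
        linarith [hmid t s t1 t2 s1]
      · obtain ⟨ht1, ht2⟩ := hX3 t t2 ht
        rw [hs1, ht1, hsm]
        rcases le_total s (w.length + 2 - t) with h1 | h1
        · refine ⟨s, le_rfl, hst, ?_⟩
          rw [hs2, ht2, abs_of_nonneg (by linarith)]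
          linarith
        · refine ⟨t, hst, le_rfl, ?_⟩
          rw [hs2, ht2, abs_of_nonpos (by linarith)]
          linarith
    rcases le_total s (w.length + 1) with s2 | s2
    · obtain ⟨hs1, hs2⟩ := hX2 s s1 s2
      rcases le_total t (w.length + 1) with t2 | t2
      · obtain ⟨ht1, ht2⟩ := hX2 t (by linarith) t2
        obtain ⟨u, hsu, hut, hu⟩ := hw.exists_norm_sub_le (s - 1) (t - 1) (by linarith)
          (by linarith) (by linarith)
        refine ⟨u + 1, by linarith, by linarith, ?_⟩
        rw [hs1, ht1, hs2, ht2, (hX2 (u + 1) (by linarith) (by linarith)).2, add_sub_add_left_eq_sub,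
          add_sub_cancel_right]
        linarith
      · obtain ⟨ht1, ht2⟩ := hX3 t t2 ht
        refine ⟨t, hst, le_rfl, ?_⟩
        rw [ht1, ht2, norm_sub_rev]
        linarith [hmid s (w.length + 2 - t) s1 s2 (by linarith)]
    · obtain ⟨hs1, hs2⟩ := hX3 s s2 (by linarith)
      obtain ⟨ht1, ht2⟩ := hX3 t (by linarith) ht
      refine ⟨t, hst, le_rfl, ?_⟩
      rw [hs1, hs2, ht1, ht2, hsm, abs_of_nonpos (by linarith)]
      linarith

theorem IsDyckWord.exists_isHeight {n : ℕ} {w : List (Fin n × Bool)} (hw : IsDyckWord w) :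
    ∃ h, IsHeight w h := by
  induction hw with
  | nil =>
    refine ⟨fun _ => 0, continuous_const, fun _ => le_rfl, fun _ _ => rfl, fun _ _ => rfl, ?_⟩
    intro s t _ hst _
    exact ⟨s, le_rfl, hst, by simp [latticePath_nil]⟩
  | append _ _ ihv ihw =>
    obtain ⟨h, hh⟩ := ihv
    obtain ⟨k, hk⟩ := ihw
    exact ⟨_, hh.append hk⟩
  | wrap a b _ ih =>
    obtain ⟨h, hh⟩ := ih
    exact ⟨_, hh.wrap a b⟩

/-- On each unit interval, the path of a word is affine. -/
theorem latticePath_add {n : ℕ} (w : List (Fin n × Bool)) (m : ℕ) (hm : m < w.length) {u : ℝ}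
    (h0 : 0 ≤ u) (h1 : u ≤ 1) :
    latticePath w (m + u) = latticePath w m + u • step w[m] := by
  rw [← sub_eq_iff_eq_add', latticePath, latticePath, ← Finset.sum_sub_distrib,
    Finset.sum_eq_single (⟨m, hm⟩ : Fin w.length)]
  · simp [h0, h1]
  · rintro ⟨k, hk⟩ - hkm
    have hkm : k ≠ m := fun h => hkm (Fin.ext h)
    simp only [← sub_smul]
    rcases lt_or_gt_of_ne hkm with h | h
    · have : (k : ℝ) + 1 ≤ m := by exact_mod_cast h
      rw [min_eq_left (by linarith), min_eq_left (by linarith), sub_self, zero_smul]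
    · have : (m : ℝ) + 1 ≤ k := by exact_mod_cast h
      rw [max_eq_left ((min_le_right _ _).trans (by linarith)),
        max_eq_left ((min_le_right _ _).trans (by linarith)), sub_self, zero_smul]
  · simp

theorem IsLatticePath.length_word {n L : ℕ} {X : ℝ → EuclideanSpace ℝ (Fin n)}
    (hX : IsLatticePath L X) : hX.word.length = L := by
  simp [IsLatticePath.word]

theorem IsLatticePath.step_word {n L : ℕ} {X : ℝ → EuclideanSpace ℝ (Fin n)}
    (hX : IsLatticePath L X) (k : ℕ) (hk : k < hX.word.length) :
    step hX.word[k] = X (k + 1) - X k := by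
  have hk' : k < L := hX.length_word ▸ hk
  rw [hX.existsUnique_word.choose_spec.1 ⟨k, hk'⟩]
  simp [IsLatticePath.word]

theorem IsLatticePath.eq_latticePath {n L : ℕ} {X : ℝ → EuclideanSpace ℝ (Fin n)}
    (hX : IsLatticePath L X) {t : ℝ} (h0 : 0 ≤ t) (ht : t ≤ L) :
    X t = X 0 + latticePath hX.word t := by
  have hint : ∀ k : ℕ, k ≤ L → X k = X 0 + latticePath hX.word k := by
    intro k
    induction k with
    | zero => intro _; simp [latticePath_of_nonpos]
    | succ k ih =>
      intro hk
      have hk' : k < hX.word.length := by rw [hX.length_word]; omega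
      have := latticePath_add hX.word k hk' zero_le_one le_rfl
      push_cast
      rw [this, ← add_assoc, ← ih (by omega), one_smul, hX.step_word k hk']
      abel
  rcases ht.eq_or_lt with rfl | hlt
  · exact hint L le_rfl
  · set k := ⌊t⌋₊
    have hk : k < L := (Nat.floor_lt h0).2 hlt
    have hk' : k < hX.word.length := by rwa [hX.length_word]
    have e0 : (k : ℝ) ≤ t := Nat.floor_le h0
    have e1 : t < k + 1 := Nat.lt_floor_add_one t
    have e2 := hX.linear k hk (t - k) ⟨by linarith, by linarith⟩
    have e3 := latticePath_add hX.word k hk' (u := t - k) (by linarith) (by linarith)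
    rw [add_sub_cancel] at e2 e3
    rw [e2, e3, hint k hk.le, hX.step_word k hk', hint k hk.le, add_assoc]

theorem IsLatticePath.isTreeLike {n L : ℕ} {X : ℝ → EuclideanSpace ℝ (Fin n)}
    (hX : IsLatticePath L X) (h : FreeGroup.mk hX.word = 1) : IsTreeLike (L : ℝ) X := by
  obtain ⟨k, hk⟩ := (isDyckWord_of_mk_eq_one h).exists_isHeight
  have hL : ((hX.word.length : ℕ) : ℝ) = L := by rw [hX.length_word]
  refine ⟨k, hk.continuous.continuousOn, fun t _ => hk.nonneg t, hk.eq_zero_of_nonpos 0 le_rfl,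
    hk.eq_zero_of_length_le _ hL.le, fun s t hs hst ht => ?_⟩
  obtain ⟨u, hsu, hut, hu⟩ := hk.exists_norm_sub_le s t hs hst (hL ▸ ht)
  rw [hX.eq_latticePath (hs.trans hst) ht, hX.eq_latticePath hs (hst.trans ht),
    add_sub_add_left_eq_sub]
  have : sInf (k '' Set.Icc s t) ≤ k u :=
    csInf_le ⟨0, by rintro _ ⟨x, -, rfl⟩; exact hk.nonneg x⟩ ⟨u, ⟨hsu, hut⟩, rfl⟩
  linarith

end LatticeSignature

end

/-! ### The development as a series of iterated integrals. -/

noncomputable section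

namespace LatticeSignature

section Development

open Finset intervalIntegral
open scoped Nat

attribute [local instance] Matrix.linftyOpNormedRing Matrix.linftyOpNormedAlgebra

theorem lipschitzWith_latticePath {n : ℕ} (w : List (Fin n × Bool)) :
    LipschitzWith w.length (latticePath w) := by
  refine LipschitzWith.of_dist_le_mul fun s t => ?_
  rw [dist_eq_norm, NNReal.coe_natCast]
  induction w generalizing s t with
  | nil => simp [latticePath_nil]
  | cons p w ih =>
    have h1 : ‖(max 0 (min 1 s) - max 0 (min 1 t)) • step p‖ ≤ dist s t := by
      rw [norm_smul, norm_step, mul_one, ← dist_eq_norm]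
      simpa using ((LipschitzWith.id (α := ℝ)).const_min 1).const_max 0 |>.dist_le_mul s t
    have h2 := ih (s - 1) (t - 1)
    rw [dist_sub_right] at h2
    rw [latticePath_cons, latticePath_cons, List.length_cons]
    calc _ = ‖(max 0 (min 1 s) - max 0 (min 1 t)) • step p +
          (latticePath w (s - 1) - latticePath w (t - 1))‖ := by congr 1; module
      _ ≤ _ := norm_add_le _ _
      _ ≤ _ := by push_cast; linarith

theorem intervalIntegrable_deriv_latticePath {n : ℕ} (w : List (Fin n × Bool)) (i : Fin n)
    (a b : ℝ) :
    IntervalIntegrable (deriv fun v => latticePath w v i) MeasureTheory.volume a b := by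
  have hL : LipschitzWith w.length fun v => latticePath w v i := by
    refine LipschitzWith.of_dist_le_mul fun s t => ?_
    refine le_trans ?_ ((lipschitzWith_latticePath w).dist_le_mul s t)
    rw [dist_eq_norm, dist_eq_norm]
    exact PiLp.norm_apply_le (latticePath w s - latticePath w t) i
  refine (intervalIntegrable_const (c := (w.length : ℝ))).mono_fun
    (measurable_deriv _).aestronglyMeasurable (.of_forall fun x => ?_)
  simpa using norm_deriv_le_of_lipschitz (x₀ := x) hL

theorem continuous_coordIteratedIntegral {n : ℕ} (w : List (Fin n × Bool)) (k : ℕ) :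
    ∀ i : Fin k → Fin n, Continuous (coordIteratedIntegral (latticePath w) k i) := by
  induction k with
  | zero => intro i; exact continuous_const
  | succ k ih =>
    intro i
    exact continuous_primitive (fun a b =>
      (intervalIntegrable_deriv_latticePath w _ a b).continuousOn_mul (ih _).continuousOn) 0

theorem coordIteratedIntegral_add {n : ℕ} (w : List (Fin n × Bool)) (k : ℕ)
    (i : Fin (k + 1) → Fin n) (m : ℕ) (hm : m < w.length) {u : ℝ} (h0 : 0 ≤ u) (h1 : u ≤ 1) :
    coordIteratedIntegral (latticePath w) (k + 1) i (m + u) =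
      coordIteratedIntegral (latticePath w) (k + 1) i m +
        (∫ v in (0 : ℝ)..u, coordIteratedIntegral (latticePath w) k (Fin.init i) (m + v)) *
          step w[m] (i (Fin.last k)) := by
  have hint : ∀ a b : ℝ, IntervalIntegrable (fun u =>
      coordIteratedIntegral (latticePath w) k (Fin.init i) u *
        deriv (fun v => latticePath w v (i (Fin.last k))) u) MeasureTheory.volume a b := fun a b =>
    (intervalIntegrable_deriv_latticePath w _ a b).continuousOn_mul
      (continuous_coordIteratedIntegral w k _).continuousOn
  rw [coordIteratedIntegral, coordIteratedIntegral, ← integral_add_adjacent_intervals (hint 0 m)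
    (hint m (m + u)), add_right_inj, ← integral_mul_const]
  have := integral_comp_add_left (fun u =>
      coordIteratedIntegral (latticePath w) k (Fin.init i) u *
        deriv (fun v => latticePath w v (i (Fin.last k))) u) (a := 0) (b := u) (m : ℝ)
  rw [add_zero] at this
  rw [← this]
  -- The path may have corners at integer times, so the derivative is computed only in the open
  -- interval.
  refine integral_congr_Ioo_of_le h0 fun v hv => ?_
  have hd : HasDerivAt (fun v => latticePath w v (i (Fin.last k)))
      (step w[m] (i (Fin.last k))) (m + v) := by
    have h2 : HasDerivAt (fun x : ℝ => latticePath w m (i (Fin.last k)) +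
        (x - m) * step w[m] (i (Fin.last k))) (step w[m] (i (Fin.last k))) (m + v) := by
      simpa using (((hasDerivAt_id (m + v : ℝ)).sub_const (m : ℝ)).mul_const
        (step w[m] (i (Fin.last k)))).const_add (latticePath w m (i (Fin.last k)))
    refine h2.congr_of_eventuallyEq ?_
    filter_upwards [Ioo_mem_nhds (a := (m : ℝ)) (b := m + 1) (x := m + v) (by linarith [hv.1])
      (by linarith [hv.2])] with x hx
    have := latticePath_add w m hm (u := x - m) (by linarith [hx.1]) (by linarith [hx.2])
    rw [add_sub_cancel] at this
    rw [this]
    simp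
  simp only [hd.deriv]

/-- The image in the matrices of an elementary tensor of basis vectors. -/
def basisProduct {k : ℕ} (i : Fin k → Fin 2) : Matrix (Fin 2) (Fin 2) ℂ :=
  (List.ofFn fun j => planeToMatrix (EuclideanSpace.single (i j) (1 : ℝ))).prod

theorem basisProduct_snoc {k : ℕ} (i : Fin k → Fin 2) (l : Fin 2) :
    basisProduct (Fin.snoc i l : Fin (k + 1) → Fin 2) =
      basisProduct i * planeToMatrix (EuclideanSpace.single l (1 : ℝ)) := by
  rw [basisProduct, List.ofFn_succ', List.concat_eq_append, List.prod_append, List.prod_singleton]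
  simp [basisProduct]

theorem glIteratedIntegral_eq_sum (Y : ℝ → EuclideanSpace ℝ (Fin 2)) (T : ℝ) (k : ℕ) :
    glIteratedIntegral Y T k =
      ∑ i : Fin k → Fin 2, coordIteratedIntegral Y k i T • basisProduct i := by
  rw [glIteratedIntegral, iteratedIntegral, map_sum]
  refine sum_congr rfl fun i _ => ?_
  rw [map_smul, TensorAlgebra.tprod_apply, map_list_prod, List.map_ofFn, basisProduct]
  congr 3
  ext1 j
  simp

theorem glIteratedIntegral_zero_right (Y : ℝ → EuclideanSpace ℝ (Fin 2)) (T : ℝ) :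
    glIteratedIntegral Y T 0 = 1 := by
  simp [glIteratedIntegral_eq_sum, coordIteratedIntegral, basisProduct]

theorem glIteratedIntegral_zero_left (Y : ℝ → EuclideanSpace ℝ (Fin 2)) (k : ℕ) :
    glIteratedIntegral Y 0 (k + 1) = 0 := by
  simp [glIteratedIntegral_eq_sum, coordIteratedIntegral]

theorem planeToMatrix_eq_sum (v : EuclideanSpace ℝ (Fin 2)) :
    planeToMatrix v = ∑ l, v l • planeToMatrix (EuclideanSpace.single l (1 : ℝ)) := by
  simp_rw [← map_smul, ← map_sum]
  congr 1
  ext j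
  fin_cases j <;> simp

theorem glIteratedIntegral_succ_add (w : List (Fin 2 × Bool)) (k : ℕ) (m : ℕ) (hm : m < w.length)
    {u : ℝ} (h0 : 0 ≤ u) (h1 : u ≤ 1) :
    glIteratedIntegral (latticePath w) (m + u) (k + 1) =
      glIteratedIntegral (latticePath w) m (k + 1) +
        (∫ v in (0 : ℝ)..u, glIteratedIntegral (latticePath w) (m + v) k) *
          planeToMatrix (step w[m]) := by
  have hI : ∫ v in (0 : ℝ)..u, glIteratedIntegral (latticePath w) (m + v) k =
      ∑ i : Fin k → Fin 2,
        (∫ v in (0 : ℝ)..u, coordIteratedIntegral (latticePath w) k i (m + v)) •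
          basisProduct i := by
    simp_rw [glIteratedIntegral_eq_sum]
    rw [integral_finsetSum]
    · simp_rw [intervalIntegral.integral_smul_const]
    · intro i _
      refine Continuous.intervalIntegrable ?_ _ _
      exact ((continuous_coordIteratedIntegral w k i).comp (by fun_prop)).smul continuous_const
  rw [hI, planeToMatrix_eq_sum (step w[m]), sum_mul_sum, glIteratedIntegral_eq_sum,
    glIteratedIntegral_eq_sum]
  simp_rw [coordIteratedIntegral_add w k _ m hm h0 h1, add_smul]
  rw [sum_add_distrib, add_right_inj, sum_comm,
    ← (Fin.snocEquiv fun _ : Fin (k + 1) => Fin 2).sum_comp, Fintype.sum_prod_type]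
  refine sum_congr rfl fun l _ => sum_congr rfl fun i _ => ?_
  simp only [Fin.snocEquiv, Equiv.coe_fn_mk, Fin.init_snoc, Fin.snoc_last]
  rw [basisProduct_snoc, smul_mul_smul_comm]

/-- The velocity is constant during one letter, so repeated integration produces the terms u^j M^j /
j! of the exponential series. -/
theorem glIteratedIntegral_add (w : List (Fin 2 × Bool)) (m : ℕ) (hm : m < w.length) (k : ℕ) :
    ∀ u : ℝ, 0 ≤ u → u ≤ 1 → glIteratedIntegral (latticePath w) (m + u) k =
      ∑ j ∈ range (k + 1), (u ^ j / j !) •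
        (glIteratedIntegral (latticePath w) m (k - j) * planeToMatrix (step w[m]) ^ j) := by
  induction k with
  | zero => intro u _ _; simp [glIteratedIntegral_zero_right]
  | succ k ih =>
    intro u h0 h1
    have hI : ∫ v in (0 : ℝ)..u, glIteratedIntegral (latticePath w) (m + v) k =
        ∑ j ∈ range (k + 1), (u ^ (j + 1) / (j + 1)!) •
          (glIteratedIntegral (latticePath w) m (k - j) * planeToMatrix (step w[m]) ^ j) := by
      rw [integral_congr (g := fun v => ∑ j ∈ range (k + 1), (v ^ j / j !) •
        (glIteratedIntegral (latticePath w) m (k - j) * planeToMatrix (step w[m]) ^ j))]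
      · rw [integral_finsetSum]
        · refine sum_congr rfl fun j _ => ?_
          rw [intervalIntegral.integral_smul_const, integral_div, integral_pow, Nat.factorial_succ]
          congr 1
          push_cast
          rw [zero_pow (by omega)]
          field_simp
          ring
        · intro j _
          exact Continuous.intervalIntegrable (by fun_prop) _ _
      · intro v hv
        rw [Set.uIcc_of_le h0] at hv
        exact ih v hv.1 (hv.2.trans h1)
    rw [glIteratedIntegral_succ_add w k m hm h0 h1, hI, sum_range_succ' _ (k + 1), add_comm, sum_mul]
    congr 1
    · refine sum_congr rfl fun j _ => ?_
      rw [smul_mul_assoc, mul_assoc, ← pow_succ, Nat.add_sub_add_right]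
    · simp

/-- Chen's identity for the last letter. -/
theorem glIteratedIntegral_succ (w : List (Fin 2 × Bool)) (m : ℕ) (hm : m < w.length) (k : ℕ) :
    glIteratedIntegral (latticePath w) (m + 1 : ℕ) k =
      ∑ p ∈ antidiagonal k, glIteratedIntegral (latticePath w) m p.1 *
        ((p.2 ! : ℝ)⁻¹ • planeToMatrix (step w[m]) ^ p.2) := by
  push_cast
  rw [glIteratedIntegral_add w m hm k 1 zero_le_one le_rfl, ← Finset.Nat.sum_antidiagonal_swap,
    Finset.Nat.sum_antidiagonal_eq_sum_range_succ_mk]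
  refine sum_congr rfl fun j _ => ?_
  simp

theorem norm_planeToMatrix_step (p : Fin 2 × Bool) : ‖planeToMatrix (step p)‖ = 1 := by
  have h : ‖(direction p : ℂ)‖ = 1 := by
    have := congrArg norm (direction_mul_conj p)
    rw [norm_mul, RCLike.norm_conj, norm_one] at this
    nlinarith [norm_nonneg (direction p : ℂ)]
  have h' : ‖(direction p : ℂ)‖₊ = 1 := NNReal.eq h
  rw [planeToMatrix_step, Matrix.linfty_opNorm_def]
  simp [Fin.univ_succ, h']

/-- Letters have operator norm 1, so Chen's identity and the binomial expansion of (m + 1)^k give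
the induction step. -/
theorem norm_glIteratedIntegral_le (w : List (Fin 2 × Bool)) (m : ℕ) (hm : m ≤ w.length) :
    ∀ k, ‖glIteratedIntegral (latticePath w) m k‖ ≤ (m : ℝ) ^ k / k ! := by
  induction m with
  | zero =>
    rintro (_ | k)
    · simp [glIteratedIntegral_zero_right]
    · simp [glIteratedIntegral_zero_left]
  | succ m ih =>
    intro k
    have ih := ih (by omega)
    rw [glIteratedIntegral_succ w m hm k]
    refine (norm_sum_le _ _).trans ?_
    rw [Nat.cast_succ, (Commute.all (m : ℝ) 1).add_pow', sum_div]
    refine sum_le_sum fun p hp => ?_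
    obtain rfl := mem_antidiagonal.1 hp
    refine (norm_mul_le _ _).trans ?_
    rw [norm_smul]
    have h1 : ‖planeToMatrix (step w[m]) ^ p.2‖ ≤ 1 := by
      refine (norm_pow_le _ _).trans ?_
      rw [norm_planeToMatrix_step, one_pow]
    have h2 : ((p.1 + p.2).choose p.1 : ℝ) = (p.1 + p.2)! / (p.1 ! * p.2 !) := by
      rw [Nat.cast_choose ℝ (Nat.le_add_right _ _), Nat.add_sub_cancel_left]
    calc _ ≤ (m : ℝ) ^ p.1 / p.1 ! * (‖(p.2 ! : ℝ)⁻¹‖ * 1) := by gcongr; exact ih _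
      _ = _ := by
        rw [nsmul_eq_mul, h2, Real.norm_of_nonneg (by positivity), one_pow]
        field_simp

/-- As M² = 1, the even powers of exp (θM) sum to cosh θ and the odd ones to sinh θ · M; here θ =
arsinh 1. -/
theorem hasSum_letterMatrix (p : Fin 2 × Bool) :
    HasSum (fun j : ℕ => Real.log (1 + √2) ^ j • ((j ! : ℝ)⁻¹ • planeToMatrix (step p) ^ j))
      (letterMatrix p) := by
  have hθ : Real.log (1 + √2) = Real.arsinh 1 := by rw [Real.arsinh]; norm_num
  have hc : Real.cosh (Real.arsinh 1) = √2 := by rw [Real.cosh_arsinh]; norm_num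
  have hs : Real.sinh (Real.arsinh 1) = 1 := Real.sinh_arsinh 1
  rw [hθ, letterMatrix]
  have he : ∀ j : ℕ, planeToMatrix (step p) ^ (2 * j) = 1 := fun j => by
    rw [pow_mul, sq, planeToMatrix_step_mul_self, one_pow]
  refine HasSum.even_add_odd ?_ ?_
  · rw [← hc]
    simpa [he, smul_smul, div_eq_mul_inv] using
      (Real.hasSum_cosh (Real.arsinh 1)).smul_const (1 : Matrix (Fin 2) (Fin 2) ℂ)
  · have := (Real.hasSum_sinh (Real.arsinh 1)).smul_const (planeToMatrix (step p))
    rw [hs, one_smul] at this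
    simpa [he, pow_succ _ (2 * _), smul_smul, div_eq_mul_inv] using this

theorem summable_norm_smul_glIteratedIntegral (w : List (Fin 2 × Bool)) (m : ℕ) (hm : m ≤ w.length)
    (θ : ℝ) : Summable fun k => ‖θ ^ k • glIteratedIntegral (latticePath w) m k‖ := by
  refine Summable.of_nonneg_of_le (fun _ => norm_nonneg _) (fun k => ?_)
    (Real.summable_pow_div_factorial (|θ| * m))
  rw [norm_smul, norm_pow, Real.norm_eq_abs, mul_pow, mul_div_assoc]
  gcongr
  exact norm_glIteratedIntegral_le w m hm k

theorem hasSum_glIteratedIntegral_take (w : List (Fin 2 × Bool)) (m : ℕ) (hm : m ≤ w.length) :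
    HasSum (fun k : ℕ => Real.log (1 + √2) ^ k • glIteratedIntegral (latticePath w) m k)
      (wordMatrix (w.take m)) := by
  induction m with
  | zero =>
    convert hasSum_single (0 : ℕ) ?_ using 1
    · simp [wordMatrix, glIteratedIntegral_zero_right]
    · rintro (_ | k) hk
      · exact absurd rfl hk
      · simp [glIteratedIntegral_zero_left]
  | succ m ih =>
    have ih := ih (by omega)
    set θ := Real.log (1 + √2)
    have h1 := summable_norm_smul_glIteratedIntegral w m (by omega) θ
    have hg := hasSum_letterMatrix w[m]
    have h2 : Summable fun j : ℕ => ‖θ ^ j • ((j ! : ℝ)⁻¹ • planeToMatrix (step w[m]) ^ j)‖ := by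
      refine Summable.of_nonneg_of_le (fun _ => norm_nonneg _) (fun k => ?_)
        (Real.summable_pow_div_factorial |θ|)
      have h1 : ‖planeToMatrix (step w[m]) ^ k‖ ≤ 1 := by
        refine (norm_pow_le _ _).trans ?_
        rw [norm_planeToMatrix_step, one_pow]
      rw [norm_smul, norm_smul, norm_pow, Real.norm_eq_abs, norm_inv,
        Real.norm_of_nonneg (Nat.cast_nonneg _), div_eq_mul_inv]
      gcongr
      exact mul_le_of_le_one_right (by positivity) h1
    -- Chen's identity is a convolution in k, so appending a letter is a Cauchy product of
    -- absolutely convergent series.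
    have h3 := (summable_norm_sum_mul_antidiagonal_of_summable_norm h1 h2).of_norm.hasSum
    have h5 : (∑' n, θ ^ n • glIteratedIntegral (latticePath w) m n) = wordMatrix (w.take m) :=
      ih.tsum_eq
    have h6 : (∑' n : ℕ, θ ^ n • ((n ! : ℝ)⁻¹ • planeToMatrix (step w[m]) ^ n)) =
      letterMatrix w[m] := hg.tsum_eq
    rw [← tsum_mul_tsum_eq_tsum_sum_antidiagonal_of_summable_norm h1 h2] at h3
    erw [h5, h6] at h3
    have h4 : wordMatrix (w.take (m + 1)) = wordMatrix (w.take m) * letterMatrix w[m] := by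
      rw [List.take_succ_eq_append_getElem hm, wordMatrix, wordMatrix, List.map_append,
        List.prod_append]
      simp
    have h7 : ∀ k : ℕ, θ ^ k • glIteratedIntegral (latticePath w) (m + 1 : ℕ) k =
        ∑ p ∈ antidiagonal k, θ ^ p.1 • glIteratedIntegral (latticePath w) m p.1 *
          θ ^ p.2 • ((p.2 ! : ℝ)⁻¹ • planeToMatrix (step w[m]) ^ p.2) := fun k => by
      rw [glIteratedIntegral_succ w m hm k, smul_sum]
      refine sum_congr rfl fun p hp => ?_
      rw [smul_mul_smul_comm, ← pow_add, mem_antidiagonal.1 hp]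
    rw [h4, funext h7]
    exact h3

theorem hasSum_glIteratedIntegral (w : List (Fin 2 × Bool)) :
    HasSum (fun k : ℕ => Real.log (1 + √2) ^ k • glIteratedIntegral (latticePath w) w.length k)
      (wordMatrix w) := by
  simpa using hasSum_glIteratedIntegral_take w w.length le_rfl

theorem norm_entry_le (A : Matrix (Fin 2) (Fin 2) ℂ) (i j : Fin 2) : ‖A i j‖ ≤ ‖A‖ := by
  rw [Matrix.linfty_opNorm_def, ← coe_nnnorm, NNReal.coe_le_coe]
  exact (single_le_sum (f := fun j => ‖A i j‖₊) (fun _ _ => zero_le) (mem_univ j)).trans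
    (le_sup (f := fun i => ∑ j, ‖A i j‖₊) (mem_univ i))

theorem norm_glIteratedIntegral_entry_le (w : List (Fin 2 × Bool)) (k : ℕ) (i j : Fin 2) :
    ‖glIteratedIntegral (latticePath w) w.length k i j‖ ≤ (w.length : ℝ) ^ k / k ! :=
  (norm_entry_le _ i j).trans (norm_glIteratedIntegral_le w w.length le_rfl k)

theorem hasSum_glIteratedIntegral_entry (w : List (Fin 2 × Bool)) (i j : Fin 2) :
    HasSum (fun k : ℕ => ((Real.log (1 + √2) ^ k : ℝ) : ℂ) *
      glIteratedIntegral (latticePath w) w.length k i j) (wordMatrix w i j) := by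
  have h := (hasSum_glIteratedIntegral w).map (Matrix.entryAddMonoidHom ℂ i j)
    (continuous_id.matrix_elem i j)
  simpa [Function.comp_def] using h

end Development

/-! ### Tail estimate. -/

section Tail

open scoped Nat

/-- Stirling gives n! ≥ √(2πn) (n/e)^n ≥ √(2πn) y^n, and √(2π) ≥ 5/2. -/
theorem pow_div_factorial_le {y : ℝ} (hy : 0 ≤ y) {n : ℕ} (hn : 1 ≤ n) (h : Real.exp 1 * y ≤ n) :
    y ^ n / n ! ≤ 2 / 5 := by
  have hn' : (1 : ℝ) ≤ n := by exact_mod_cast hn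
  have h1 := Stirling.le_factorial_stirling n
  have h2 : (5 / 2 : ℝ) ≤ √(2 * Real.pi * n) := by
    refine Real.le_sqrt_of_sq_le ?_
    nlinarith [Real.pi_gt_d2]
  have h3 : y ^ n ≤ (n / Real.exp 1) ^ n := by
    gcongr
    rw [le_div_iff₀ (Real.exp_pos 1)]
    linarith
  rw [div_le_iff₀ (by positivity)]
  have h4 : 0 ≤ (n / Real.exp 1) ^ n := by positivity
  nlinarith

/-- Beyond the first term, at most 2/5, the bounds decay with ratio y/n ≤ 1/e ≤ 1/2, so the sum is
at most 4/5. -/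
theorem norm_lt_one_of_hasSum {a : ℕ → ℂ} {s : ℂ} (hs : HasSum a s) {y : ℝ} (hy : 0 ≤ y)
    (ha : ∀ k, ‖a k‖ ≤ y ^ k / k !) {n : ℕ} (hn : 1 ≤ n) (h : Real.exp 1 * y ≤ n)
    (h0 : ∀ k < n, a k = 0) : ‖s‖ < 1 := by
  have hn' : (0 : ℝ) < n := by exact_mod_cast hn
  have h1 : HasSum (fun j => a (j + n)) s := by
    have := (hasSum_nat_add_iff' n).2 hs
    rwa [Finset.sum_eq_zero fun k hk => h0 k (Finset.mem_range.1 hk), sub_zero] at this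
  have h2 : ∀ j, ‖a (j + n)‖ ≤ 2 / 5 * (1 / 2 : ℝ) ^ j := by
    intro j
    refine (ha _).trans ?_
    have hf : (n ! : ℝ) * n ^ j ≤ (j + n)! := by
      rw [add_comm]; exact_mod_cast (Nat.mul_le_mul_left _ (Nat.pow_le_pow_left n.le_succ j)).trans
        Nat.factorial_mul_pow_le_factorial
    have hyn : y / n ≤ 1 / 2 := by
      rw [div_le_iff₀ hn']
      nlinarith [Real.exp_one_gt_d9]
    calc y ^ (j + n) / (j + n)! ≤ y ^ (j + n) / (n ! * n ^ j) := by gcongr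
      _ = y ^ n / n ! * (y / n) ^ j := by rw [pow_add, div_pow]; field_simp
      _ ≤ _ := by
        exact mul_le_mul (pow_div_factorial_le hy hn h) (pow_le_pow_left₀ (by positivity) hyn j)
          (by positivity) (by norm_num)
  have h3 := (hasSum_geometric_of_lt_one (r := (1 / 2 : ℝ)) (by norm_num) (by norm_num)).mul_left
    (2 / 5)
  have h4 := tsum_of_norm_bounded h3 h2
  rw [h1.tsum_eq] at h4
  norm_num at h4
  linarith

end Tail

/-! ### Substitution of words and conclusion. -/

theorem length_substWord_le {d n : ℕ} (f : Fin d → FreeGroup (Fin n)) {c : ℤ}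
    (hf : ∀ i, ((f i).toWord.length : ℤ) ≤ c) (w : List (Fin d × Bool)) :
    ((substWord f w).length : ℤ) ≤ c * w.length := by
  induction w with
  | nil => simp [substWord]
  | cons p w ih =>
    have h : substWord f (p :: w) =
        (if p.2 then (f p.1).toWord else ((f p.1)⁻¹).toWord) ++ substWord f w := by
      simp [substWord]
    rw [h, List.length_append, List.length_cons]
    push_cast
    have : (((if p.2 then (f p.1).toWord else ((f p.1)⁻¹).toWord).length : ℕ) : ℤ) ≤ c := by
      split_ifs
      · exact hf p.1
      · rw [FreeGroup.toWord_inv, FreeGroup.invRev_length]; exact hf p.1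
    linarith

theorem mk_substWord {d n : ℕ} (f : Fin d → FreeGroup (Fin n)) (w : List (Fin d × Bool)) :
    FreeGroup.mk (substWord f w) = FreeGroup.lift f (FreeGroup.mk w) := by
  induction w with
  | nil => simp [substWord, ← FreeGroup.one_eq_mk]
  | cons p w ih =>
    have h : substWord f (p :: w) =
        (if p.2 then (f p.1).toWord else ((f p.1)⁻¹).toWord) ++ substWord f w := by
      simp [substWord]
    rw [h, ← FreeGroup.mul_mk, ih, ← List.singleton_append, ← FreeGroup.mul_mk, map_mul]
    congr 1
    obtain ⟨i, b⟩ := p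
    cases b <;> simp [FreeGroup.mk_toWord, ← FreeGroup.inv_mk]

/-- A word is trivial in the free group once enough of the iterated integrals of its path have a
vanishing projection. -/
theorem mk_eq_one_of_glIteratedIntegral_eq_zero (v : List (Fin 2 × Bool)) {y : ℝ}
    (hy : Real.log (1 + √2) * v.length ≤ y)
    (h : ∀ k : ℕ, 1 ≤ k → k ≤ ⌊Real.exp 1 * y⌋₊ →
      glIteratedIntegral (latticePath v) v.length k = 0) : FreeGroup.mk v = 1 := by
  have hθ : 0 ≤ Real.log (1 + √2) := Real.log_nonneg (by linarith [Real.sqrt_nonneg 2])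
  have hy0 : 0 ≤ y := le_trans (by positivity) hy
  refine mk_eq_one_of_norm_wordMatrix_lt_one v
    (norm_lt_one_of_hasSum (hasSum_glIteratedIntegral_entry v 1 0) hy0 (fun k => ?_)
      (n := ⌊Real.exp 1 * y⌋₊ + 1) (by omega) ?_ fun k hk => ?_)
  · rw [norm_mul, Complex.norm_real, Real.norm_of_nonneg (by positivity)]
    calc _ ≤ Real.log (1 + √2) ^ k * ((v.length : ℝ) ^ k / Nat.factorial k) := by
          gcongr; exact norm_glIteratedIntegral_entry_le v k 1 0
      _ = (Real.log (1 + √2) * v.length) ^ k / Nat.factorial k := by rw [mul_pow, mul_div_assoc]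
      _ ≤ _ := by gcongr
  · push_cast
    exact (Nat.lt_floor_add_one _).le
  · rcases Nat.eq_zero_or_pos k with rfl | hk0
    -- The term of degree 0 is the identity matrix, which is why an off-diagonal entry is used.
    · simp [glIteratedIntegral_zero_right]
    · simp [h k hk0 (by omega)]

end LatticeSignature

end

theorem mainTheorem7 (d : ℕ) (hd : 1 ≤ d) :
    (∃ f : Fin d → FreeGroup (Fin 2), LatticeSignature.IsShortEmbedding f) ∧
    ∀ f : Fin d → FreeGroup (Fin 2), LatticeSignature.IsShortEmbedding f →
      ∀ (L : ℕ) (X : ℝ → EuclideanSpace ℝ (Fin d)) (hX : LatticeSignature.IsLatticePath L X),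
        (∀ k : ℕ, 1 ≤ k →
          k ≤ ⌊(LatticeSignature.embeddingLength d : ℝ) * Real.exp 1 *
            Real.log (1 + √2) * (L : ℝ)⌋₊ →
          LatticeSignature.glIteratedIntegral
            (LatticeSignature.latticePath (LatticeSignature.substWord f hX.word))
            ((LatticeSignature.substWord f hX.word).length : ℝ) k = 0) →
        LatticeSignature.IsTreeLike (L : ℝ) X := by
  refine ⟨LatticeSignature.exists_isShortEmbedding d hd, fun f hf L X hX h => ?_⟩
  refine hX.isTreeLike (hf.1 ?_)
  rw [map_one, ← LatticeSignature.mk_substWord]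
  have hlen := LatticeSignature.length_substWord_le f hf.2 hX.word
  rw [hX.length_word] at hlen
  have hlen' : ((LatticeSignature.substWord f hX.word).length : ℝ) ≤
      LatticeSignature.embeddingLength d * L := by exact_mod_cast hlen
  -- This y bounds θ times the length of the substituted word, and e y is the threshold of the
  -- theorem before rounding.
  refine LatticeSignature.mk_eq_one_of_glIteratedIntegral_eq_zero _
    (y := Real.log (1 + √2) * (LatticeSignature.embeddingLength d * L)) ?_ fun k h1 h2 => ?_
  · gcongr
    exact Real.log_nonneg (by linarith [Real.sqrt_nonneg 2])
  · refine h k h1 (h2.trans_eq ?_)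
    congr 1
    ring
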